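/- Let $\epsilon>0$. There is a number $R>0$, depending only on $\epsilon$, with the following property. Let $\Sigma\subset\mathbb{R}^3$ be a properly immersed smooth self-shrinker (without boundary, hence complete), i.e. an immersed surface that satisfies $H=\frac{\langle x,\nu\rangle}{2}$, where $\nu$ is a local unit normal, $H=\operatorname{div}_\Sigma(\nu)$ is the mean curvature and $x$ is the position vector. Let $r_0\ge R$ and let $\Sigma_0$ be an end of $\Sigma$, i.e. a connected component of the part of $\Sigma$ outside the closed ball $\overline{B}(0,r_0)$ (if $\Sigma$ is not embedded, components are taken in the source of the immersion). Suppose that for all $r>r_0$ the end $\Sigma_0$ meets the sphere $S(0,r)$ transversally, and that for all $r>r_0$ the curves $\Sigma_0\cap S(0,r)$ have geodesic curvature in $S(0,r)$ of absolute value at most $\frac12-\epsilon$ (this holds in particular if their curvature as curves in $\mathbb{R}^3$ is at most $\frac12-\epsilon$). Then $|H|\le 2$ on $\Sigma_0$. -/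

import Mathlib

open scoped Manifold ContDiff Topology

noncomputable section

/-- The Euclidean plane, on which surfaces are modelled. -/
abbrev E2 : Type := EuclideanSpace ℝ (Fin 2)

/-- Euclidean three-space. -/
abbrev E3 : Type := EuclideanSpace ℝ (Fin 3)

section Surfaces

variable {M : Type*} [TopologicalSpace M] [ChartedSpace E2 M]

/-- The differential at `p` of a map from a surface to `ℝ³` (the tangent space at `p` is, as a
vector space, the model space `E2`). -/
def surfaceDiff (F : M → E3) (p : M) : E2 →L[ℝ] E3 :=
  mfderiv 𝓘(ℝ, E2) 𝓘(ℝ, E3) F p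

/-- The first fundamental form `⟨dF eᵢ, dF eⱼ⟩` in the standard basis of the tangent space. -/
def firstFundamentalForm (F : M → E3) (p : M) : Matrix (Fin 2) (Fin 2) ℝ :=
  Matrix.of fun i j =>
    inner ℝ (surfaceDiff F p (EuclideanSpace.single i 1))
      (surfaceDiff F p (EuclideanSpace.single j 1))

/-- The divergence along the surface `F` of a vector field `N` with values in `ℝ³`,
`div N = ∑ gⁱʲ ⟨dN eᵢ, dF eⱼ⟩`, i.e. the sum of `⟨dN uᵢ, dF uᵢ⟩` over a basis `u₁, u₂` of the
tangent space that is orthonormal for the induced metric. -/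
def surfaceDiv (F N : M → E3) (p : M) : ℝ :=
  ((firstFundamentalForm F p)⁻¹ * Matrix.of fun i j : Fin 2 =>
    (inner ℝ (surfaceDiff N p (EuclideanSpace.single i 1))
      (surfaceDiff F p (EuclideanSpace.single j 1)) : ℝ)).trace

/-- `N` is, near `p`, a smooth field of unit vectors normal to the surface `F`. Near each point of
an immersed surface there are exactly two such fields (as germs), differing by sign. -/
def IsUnitNormalNear (F N : M → E3) (p : M) : Prop :=
  ContMDiffAt 𝓘(ℝ, E2) 𝓘(ℝ, E3) ∞ N p ∧
    ∀ᶠ q in 𝓝 p, ‖N q‖ = 1 ∧ ∀ v : E2, inner ℝ (surfaceDiff F q v) (N q) = 0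

/-- `F : M → ℝ³` is a properly immersed smooth surface satisfying the self-shrinker equation
`H = ⟨x, ν⟩ / 2`, where `H = div ν`. The equation does not change when `ν` is replaced by `-ν`,
so it is required for both choices of a local unit normal, and `M` need not be orientable. -/
structure IsProperSelfShrinker (F : M → E3) : Prop where
  smooth : ContMDiff 𝓘(ℝ, E2) 𝓘(ℝ, E3) ∞ F
  immersion : ∀ p, Function.Injective (surfaceDiff F p)
  proper : IsProperMap F
  shrinker : ∀ (p : M) (N : M → E3), IsUnitNormalNear F N p →
    surfaceDiv F N p = inner ℝ (F p) (N p) / 2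

/-- `S` is an end of the surface `F` outside the ball of radius `r₀`: a connected component of the
part of the surface lying outside the closed ball. -/
def IsEnd (F : M → E3) (r₀ : ℝ) (S : Set M) : Prop :=
  ∃ p, r₀ < ‖F p‖ ∧ S = connectedComponentIn {q | r₀ < ‖F q‖} p

/-- The part `S` of the surface `F` meets the sphere `S(0, r)` transversally: at common points,
the tangent plane of the surface and that of the sphere, `x^⊥`, span `ℝ³`. -/
def MeetsSphereTransversally (F : M → E3) (S : Set M) (r : ℝ) : Prop :=
  ∀ p ∈ S, ‖F p‖ = r →
    LinearMap.range (surfaceDiff F p : E2 →ₗ[ℝ] E3) ⊔ (Submodule.span ℝ {F p})ᗮ = ⊤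

/-- The absolute value of the geodesic curvature in `S(0, r)`, at parameter `t`, of a unit speed
curve `γ` lying on `S(0, r)`: the length of the component of `γ''` tangent to the sphere. -/
def sphereGeodesicCurvature (γ : ℝ → E3) (t : ℝ) : ℝ :=
  ‖(Submodule.span ℝ {γ t})ᗮ.starProjection (deriv (deriv γ) t)‖

/-- The curves in which the part `S` of the surface `F` meets the sphere `S(0, r)` have geodesic
curvature at most `κ` in absolute value; it is computed in local unit speed parametrizations
`F ∘ c` of these curves. -/
def SphereTraceCurvatureLE (F : M → E3) (S : Set M) (r κ : ℝ) : Prop :=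
  ∀ (a b : ℝ) (c : ℝ → M), ContMDiffOn 𝓘(ℝ, ℝ) 𝓘(ℝ, E2) ∞ c (Set.Ioo a b) →
    (∀ t ∈ Set.Ioo a b, c t ∈ S ∧ ‖F (c t)‖ = r ∧ ‖deriv (F ∘ c) t‖ = 1) →
    ∀ t ∈ Set.Ioo a b, sphereGeodesicCurvature (F ∘ c) t ≤ κ

/-- The mean curvature `H = div ν` of the surface `F` satisfies `|H| ≤ K` on `S`. -/
def MeanCurvatureBoundedBy (F : M → E3) (S : Set M) (K : ℝ) : Prop :=
  ∀ p ∈ S, ∀ N : M → E3, IsUnitNormalNear F N p → |surfaceDiv F N p| ≤ K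

end Surfaces

end

/-! Put `s = ⟨x, ν⟩ = 2H`. By transversality the tangential part of `x` is nonzero and orthogonal to
the tangent of the spherical section. If `k` is the normal curvature along that section, tracing the
second fundamental form gives `s/2 - k` in the radial direction. Since `|k| ≤ κ + |s|/|x|²`
(`abs_inner_deriv_normal_le`), with `κ ≤ 1/2` and `|x| ≥ 4`, the bound `|s| > 4` makes `s² - 2|x|²`
increase outwards (`exists_path_normal_growth`). On the other hand `s² ≤ |x|²`, so this growth
cannot last. If `|s| > 4` at a point of norm `r`, maximize `s² - 2|x|²` over the compact part of the
end where `r² ≤ |x|² ≤ 2r²`. A maximum with `|x|² < 2r²` contradicts the growth; one with `|x|² =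
2r²` would have `s² > 2r² = |x|²`. Hence `R = 4` works for every `ε`. -/

/-! ### Linear algebra of an immersed plane. -/

/-- The trace of `(LᵀL)⁻¹ KᵀL` is computed in any basis that `L` maps to an orthonormal system. -/
lemma trace_gram_inv_mul_eq_sum (L K : E2 →L[ℝ] E3) (u : Fin 2 → E2)
    (hu : ∀ i j, inner ℝ (L (u i)) (L (u j)) = if i = j then (1 : ℝ) else 0) :
    ((Matrix.of fun i j : Fin 2 => (inner ℝ (L (EuclideanSpace.single i 1))
        (L (EuclideanSpace.single j 1)) : ℝ))⁻¹ *
      Matrix.of fun i j : Fin 2 => (inner ℝ (K (EuclideanSpace.single i 1))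
        (L (EuclideanSpace.single j 1)) : ℝ)).trace =
      ∑ i, inner ℝ (K (u i)) (L (u i)) := by
  set U : Matrix (Fin 2) (Fin 2) ℝ := Matrix.of fun i j => u j i with hU
  have hexp (a : Fin 2) : u a = ∑ i, u a i • EuclideanSpace.single i (1 : ℝ) := by
    ext k
    fin_cases k <;> simp
  have key (T : E2 →L[ℝ] E3) (a b : Fin 2) :
      inner ℝ (T (u a)) (L (u b)) = (U.transpose * (Matrix.of fun i j : Fin 2 =>
        (inner ℝ (T (EuclideanSpace.single i 1)) (L (EuclideanSpace.single j 1)) : ℝ)) * U) a b := by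
    rw [hexp a, hexp b]
    simp only [Fin.sum_univ_two, Matrix.mul_apply, map_add, map_smul, inner_add_left,
      inner_add_right, real_inner_smul_left, real_inner_smul_right, hU, Matrix.transpose_apply,
      Matrix.of_apply]
    ring
  set G : Matrix (Fin 2) (Fin 2) ℝ := Matrix.of fun i j => inner ℝ (L (EuclideanSpace.single i 1))
    (L (EuclideanSpace.single j 1)) with hG
  set B : Matrix (Fin 2) (Fin 2) ℝ := Matrix.of fun i j => inner ℝ (K (EuclideanSpace.single i 1))
    (L (EuclideanSpace.single j 1)) with hB
  have h1 : U.transpose * G * U = 1 := by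
    ext a b
    rw [← key L a b, hu, Matrix.one_apply]
  -- For square matrices `Uᵀ G U = 1` forces `G⁻¹ = U Uᵀ`; cyclicity of the trace then leaves `tr
  -- (Uᵀ B U)`.
  have h2 : U * U.transpose * G = 1 := by
    rw [Matrix.mul_assoc]
    exact mul_eq_one_comm.mp h1
  rw [Matrix.inv_eq_left_inv h2, Matrix.mul_assoc, Matrix.trace_mul_comm, Matrix.trace]
  exact Finset.sum_congr rfl fun i _ => (key K i i).symm

/-- A unit vector normal to an injectively immersed plane spans, with it, the whole space. -/
lemma exists_eq_add_smul_normal (L : E2 →L[ℝ] E3) (hL : Function.Injective L) (n : E3)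
    (hn : ‖n‖ = 1) (hLn : ∀ v, inner ℝ (L v) n = 0) (x : E3) :
    ∃ w, x = L w + (inner ℝ x n : ℝ) • n := by
  set V : Submodule ℝ E3 := LinearMap.range (L : E2 →ₗ[ℝ] E3) with hV
  have hfin : Module.finrank ℝ V = 2 := by
    rw [hV, LinearMap.finrank_range_of_inj hL]
    simp
  have hfin' : Module.finrank ℝ Vᗮ = 1 := by
    have := V.finrank_add_finrank_orthogonal
    simp only [hfin, finrank_euclideanSpace, Fintype.card_fin] at this
    omega
  have hnV : n ∈ Vᗮ := by
    rw [Submodule.mem_orthogonal]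
    rintro _ ⟨v, rfl⟩
    exact hLn v
  have hn0 : (⟨n, hnV⟩ : Vᗮ) ≠ 0 := by
    intro h
    have : n = 0 := congrArg Subtype.val h
    simp [this] at hn
  obtain ⟨w, hw⟩ : V.starProjection x ∈ V := by simp
  obtain ⟨a, ha⟩ := (finrank_eq_one_iff_of_nonzero' _ hn0).mp hfin'
    ⟨x - V.starProjection x, V.sub_starProjection_mem_orthogonal x⟩
  have ha' : a • n = x - L w := by
    have := congrArg Subtype.val ha
    simpa [← hw] using this
  refine ⟨w, ?_⟩
  have hx : x = L w + a • n := by rw [ha']; abel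
  have : (inner ℝ x n : ℝ) = a := by
    rw [hx, inner_add_left, hLn, real_inner_smul_left, real_inner_self_eq_norm_sq, hn]
    ring
  rw [this]
  exact hx

/-! ### Level curves and normals in the plane of a chart. -/

/-- A smooth vector field has smooth integral curves. -/
lemma exists_contDiffOn_integralCurve {X : E2 → E2} {U : Set E2} (hU : IsOpen U)
    (hX : ContDiffOn ℝ ∞ X U) {y : E2} (hy : y ∈ U) :
    ∃ δ > 0, ∃ c : ℝ → E2, c 0 = y ∧ ContDiffOn ℝ ∞ c (Set.Ioo (-δ) δ) ∧
      ∀ t ∈ Set.Ioo (-δ) δ, c t ∈ U ∧ HasDerivAt c (X (c t)) t := by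
  have hX1 : ContDiffAt ℝ 1 X y := ((hX.contDiffAt (hU.mem_nhds hy)).of_le (by simp))
  obtain ⟨c, hc0, η, hη, hc⟩ := hX1.exists_forall_mem_closedBall_exists_eq_forall_mem_Ioo_hasDerivAt₀ 0
  simp only [zero_sub, zero_add] at hc
  have hcont : ContinuousAt c 0 := (hc 0 (by simpa using hη)).continuousAt
  have hev : ∀ᶠ t in 𝓝 (0 : ℝ), c t ∈ U := hcont.eventually (by rw [hc0]; exact hU.mem_nhds hy)
  obtain ⟨δ', hδ', hδU⟩ := Metric.eventually_nhds_iff_ball.mp hev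
  refine ⟨min η δ', lt_min hη hδ', c, hc0, ?_, ?_⟩
  all_goals
    set δ := min η δ' with hδ
    have H : ∀ t ∈ Set.Ioo (-δ) δ, c t ∈ U ∧ HasDerivAt c (X (c t)) t := by
      intro t ht
      have h1 : δ ≤ η := min_le_left _ _
      have h2 : δ ≤ δ' := min_le_right _ _
      refine ⟨hδU t ?_, hc t ⟨by linarith [ht.1], by linarith [ht.2]⟩⟩
      rw [Metric.mem_ball, Real.dist_0_eq_abs, abs_lt]
      exact ⟨by linarith [ht.1], by linarith [ht.2]⟩
  · have hdiff : DifferentiableOn ℝ c (Set.Ioo (-δ) δ) := fun t ht =>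
      (H t ht).2.differentiableAt.differentiableWithinAt
    -- Bootstrapping: if `c` is `Cⁿ`, so is `c' = X ∘ c`.
    have hn : ∀ n : ℕ, ContDiffOn ℝ n c (Set.Ioo (-δ) δ) := by
      intro n
      induction n with
      | zero => exact contDiffOn_zero.mpr hdiff.continuousOn
      | succ k ih =>
        push_cast
        rw [contDiffOn_succ_iff_deriv_of_isOpen isOpen_Ioo]
        refine ⟨hdiff, by simp, ?_⟩
        refine ContDiffOn.congr (f := fun t => X (c t)) ?_ fun t ht => (H t ht).2.deriv
        exact (hX.of_le (by exact_mod_cast le_top)).comp ih fun t ht => (H t ht).1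
    exact contDiffOn_infty.mpr hn
  · exact H

/-- Through a point of a surface at which the distance to the origin is not critical there passes
a smooth unit speed curve of constant distance to the origin. -/
lemma exists_unitSpeed_levelCurve {f : E2 → E3} {U : Set E2} (hU : IsOpen U)
    (hf : ContDiffOn ℝ ∞ f U) {y : E2} (hy : y ∈ U) (hinj : Function.Injective (fderiv ℝ f y))
    (hreg : ∃ v, inner ℝ (fderiv ℝ f y v) (f y) ≠ (0 : ℝ)) :
    ∃ δ > 0, ∃ c : ℝ → E2, c 0 = y ∧ ContDiffOn ℝ ∞ c (Set.Ioo (-δ) δ) ∧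
      ∀ t ∈ Set.Ioo (-δ) δ, c t ∈ U ∧ ‖f (c t)‖ = ‖f y‖ ∧ ‖deriv (f ∘ c) t‖ = 1 := by
  set e : Fin 2 → E2 := fun i => EuclideanSpace.single i 1 with he
  have hdf : ContDiffOn ℝ ∞ (fderiv ℝ f) U := hf.fderiv_of_isOpen hU (by simp)
  set a : Fin 2 → E2 → ℝ := fun i z => inner ℝ (fderiv ℝ f z (e i)) (f z) with ha
  have hsa (i : Fin 2) : ContDiffOn ℝ ∞ (a i) U :=
    (hdf.clm_apply contDiffOn_const).inner ℝ hf
  -- The coordinate gradient of `‖f‖² / 2`, turned by a right angle, lies in the kernel of its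
  -- differential.
  set V : E2 → E2 := fun z => a 0 z • e 1 - a 1 z • e 0 with hV
  have hsV : ContDiffOn ℝ ∞ V U :=
    ((hsa 0).smul contDiffOn_const).sub ((hsa 1).smul contDiffOn_const)
  set W : E2 → E3 := fun z => fderiv ℝ f z (V z) with hW
  have hsW : ContDiffOn ℝ ∞ W U := hdf.clm_apply hsV
  have hWf (z : E2) : inner ℝ (W z) (f z) = (0 : ℝ) := by
    simp only [hW, hV, map_sub, map_smul, inner_sub_left, real_inner_smul_left, ha]
    ring
  have hWy : W y ≠ 0 := by
    intro h
    have hVy : V y = 0 := hinj (by rw [map_zero]; exact h)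
    obtain ⟨v, hv⟩ := hreg
    have h0 : a 0 y = 0 := by
      have := congrArg (fun w : E2 => w 1) hVy
      simpa [hV, he] using this
    have h1 : a 1 y = 0 := by
      have := congrArg (fun w : E2 => w 0) hVy
      simpa [hV, he] using this
    apply hv
    have hexp : v = v 0 • e 0 + v 1 • e 1 := by
      ext k
      fin_cases k <;> simp [he]
    rw [hexp, map_add, map_smul, map_smul, inner_add_left, real_inner_smul_left,
      real_inner_smul_left]
    change v 0 * a 0 y + v 1 * a 1 y = 0
    rw [h0, h1]
    ring
  set U' : Set E2 := U ∩ W ⁻¹' {0}ᶜ with hU'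
  have hU'o : IsOpen U' := hsW.continuousOn.isOpen_inter_preimage hU isOpen_compl_singleton
  have hX : ContDiffOn ℝ ∞ (fun z => ‖W z‖⁻¹ • V z) U' := by
    refine ContDiffOn.smul (ContDiffOn.inv (f := fun z => ‖W z‖) ?_ ?_)
      (hsV.mono Set.inter_subset_left)
    · exact (hsW.mono Set.inter_subset_left).norm ℝ fun z hz => hz.2
    · exact fun z hz => norm_ne_zero_iff.mpr hz.2
  obtain ⟨δ, hδ, c, hc0, hcs, hc⟩ := exists_contDiffOn_integralCurve hU'o hX (y := y) ⟨hy, hWy⟩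
  have hder : ∀ t ∈ Set.Ioo (-δ) δ, HasDerivAt (f ∘ c) (‖W (c t)‖⁻¹ • W (c t)) t := by
    intro t ht
    have hfd : HasFDerivAt f (fderiv ℝ f (c t)) (c t) :=
      ((hf.contDiffAt (hU.mem_nhds (hc t ht).1.1)).differentiableAt (by simp)).hasFDerivAt
    have := hfd.comp_hasDerivAt t (hc t ht).2
    simpa only [map_smul] using this
  have hder2 : ∀ t ∈ Set.Ioo (-δ) δ, HasDerivAt (fun t => ‖f (c t)‖ ^ 2) 0 t := by
    intro t ht
    have := (hder t ht).norm_sq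
    simpa [real_inner_smul_right, real_inner_comm (W (c t)), hWf] using this
  refine ⟨δ, hδ, c, hc0, hcs, fun t ht => ⟨(hc t ht).1.1, ?_, ?_⟩⟩
  · have := isOpen_Ioo.is_const_of_deriv_eq_zero isPreconnected_Ioo
      (fun s hs => (hder2 s hs).differentiableAt.differentiableWithinAt)
      (fun s hs => (hder2 s hs).deriv) ht (show (0 : ℝ) ∈ Set.Ioo (-δ) δ from ⟨by linarith, hδ⟩)
    simp only [hc0] at this
    exact (sq_eq_sq₀ (norm_nonneg _) (norm_nonneg _)).mp this
  · rw [(hder t ht).deriv, norm_smul, norm_inv, norm_norm,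
      inv_mul_cancel₀ (norm_ne_zero_iff.mpr (hc t ht).1.2)]

/-- The normal curvature of a surface along a unit speed curve on the sphere is controlled by the
geodesic curvature of the curve in the sphere. -/
lemma abs_inner_deriv_normal_le {γ n : ℝ → E3} {r : ℝ} (hr : 0 < r)
    (hγ : ContDiffAt ℝ 2 γ 0) {n' : E3} (hn : HasDerivAt n n' 0) (hn1 : ‖n 0‖ = 1)
    (hγr : ∀ᶠ t in 𝓝 0, ‖γ t‖ = r) (hγ1 : ∀ᶠ t in 𝓝 0, ‖deriv γ t‖ = 1)
    (hγn : ∀ᶠ t in 𝓝 0, inner ℝ (deriv γ t) (n t) = (0 : ℝ)) :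
    |inner ℝ n' (deriv γ 0)| ≤ sphereGeodesicCurvature γ 0 + |inner ℝ (γ 0) (n 0)| / r ^ 2 := by
  have hd : ∀ᶠ t in 𝓝 (0 : ℝ), HasDerivAt γ (deriv γ t) t := by
    filter_upwards [hγ.eventually (by simp)] with t ht
    exact (ht.differentiableAt (by simp)).hasDerivAt
  have hdd : HasDerivAt (deriv γ) (deriv (deriv γ) 0) 0 := by
    have : ContDiffAt ℝ 1 (deriv γ) 0 := by
      exact (hγ.fderiv_right (m := 1) (by norm_num)).clm_apply contDiffAt_const
    exact (this.differentiableAt (by simp)).hasDerivAt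
  have h1 : ∀ᶠ t in 𝓝 0, inner ℝ (deriv γ t) (γ t) = (0 : ℝ) := by
    filter_upwards [hγr.eventually_nhds, hd] with t ht hdt
    have h := hdt.norm_sq
    have h' : HasDerivAt (fun s => ‖γ s‖ ^ 2) 0 t := by
      refine (hasDerivAt_const t (r ^ 2)).congr_of_eventuallyEq ?_
      filter_upwards [ht] with s hs using by rw [hs]
    have := h.unique h'
    rw [real_inner_comm]
    linarith
  have h2 : inner ℝ (deriv (deriv γ) 0) (γ 0) = (-1 : ℝ) := by
    have h := hdd.inner ℝ hd.self_of_nhds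
    have h' : HasDerivAt (fun s => (inner ℝ (deriv γ s) (γ s) : ℝ)) 0 0 :=
      (hasDerivAt_const _ _).congr_of_eventuallyEq h1
    have := h.unique h'
    rw [real_inner_self_eq_norm_sq, hγ1.self_of_nhds] at this
    linarith
  have h3 : inner ℝ (deriv (deriv γ) 0) (n 0) = - (inner ℝ n' (deriv γ 0) : ℝ) := by
    have h := hdd.inner ℝ hn
    have h' : HasDerivAt (fun s => (inner ℝ (deriv γ s) (n s) : ℝ)) 0 0 :=
      (hasDerivAt_const _ _).congr_of_eventuallyEq hγn
    have := h.unique h'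
    rw [real_inner_comm (deriv γ 0) n']
    linarith
  have hγ0 : ‖γ 0‖ = r := hγr.self_of_nhds
  -- The radial part of `γ''` is fixed by `⟨γ'', γ⟩ = -1`; it yields the error term `|⟨γ, n⟩| / r²`.
  have h4 : deriv (deriv γ) 0 = (Submodule.span ℝ {γ 0})ᗮ.starProjection (deriv (deriv γ) 0)
      - (1 / r ^ 2) • γ 0 := by
    rw [Submodule.starProjection_orthogonal_val, Submodule.starProjection_singleton]
    simp only [RCLike.ofReal_real_eq_id, id_eq, hγ0]
    rw [real_inner_comm, h2]
    rw [neg_div, neg_smul]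
    abel
  have h5 : inner ℝ n' (deriv γ 0) = - (inner ℝ ((Submodule.span ℝ {γ 0})ᗮ.starProjection
      (deriv (deriv γ) 0)) (n 0) : ℝ) + (inner ℝ (γ 0) (n 0) : ℝ) / r ^ 2 := by
    have h := h3
    rw [h4, inner_sub_left, real_inner_smul_left] at h
    rw [div_eq_inv_mul, ← one_div]
    linarith
  rw [h5]
  refine (abs_add_le _ _).trans (add_le_add ?_ ?_)
  · rw [abs_neg]
    refine (abs_real_inner_le_norm _ _).trans ?_
    rw [hn1, mul_one, sphereGeodesicCurvature]
  · rw [abs_div, abs_of_pos (pow_pos hr 2)]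

/-- An immersed surface in a chart has a smooth unit normal field. -/
lemma exists_contDiffOn_unitNormal {f : E2 → E3} {U : Set E2} (hU : IsOpen U)
    (hf : ContDiffOn ℝ ∞ f U) (hinj : ∀ y ∈ U, Function.Injective (fderiv ℝ f y)) :
    ∃ n : E2 → E3, ContDiffOn ℝ ∞ n U ∧
      ∀ y ∈ U, ‖n y‖ = 1 ∧ ∀ v, inner ℝ (fderiv ℝ f y v) (n y) = (0 : ℝ) := by
  set e : Fin 2 → E2 := fun i => EuclideanSpace.single i 1 with he
  have hdf : ContDiffOn ℝ ∞ (fderiv ℝ f) U := hf.fderiv_of_isOpen hU (by simp)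
  set d : Fin 2 → E2 → E3 := fun i z => fderiv ℝ f z (e i) with hd
  have hsd (i : Fin 2) : ContDiffOn ℝ ∞ (d i) U := hdf.clm_apply contDiffOn_const
  set m : E2 → E3 := fun z => WithLp.toLp 2 (crossProduct (d 0 z).ofLp (d 1 z).ofLp) with hm
  have hsm : ContDiffOn ℝ ∞ m U := by
    have h (i : Fin 2) (k : Fin 3) : ContDiffOn ℝ ∞ (fun z => d i z k) U :=
      (contDiffOn_euclidean.mp (hsd i)) k
    rw [contDiffOn_euclidean]
    intro k
    simp only [hm, cross_apply]
    fin_cases k <;> simp <;>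
      exact ((h 0 _).mul (h 1 _)).sub ((h 0 _).mul (h 1 _))
  have hexp (v : E2) : v = v 0 • e 0 + v 1 • e 1 := by
    ext k
    fin_cases k <;> simp [he]
  have hm0 : ∀ z ∈ U, m z ≠ 0 := by
    intro z hz h
    have h0 : crossProduct (d 0 z).ofLp (d 1 z).ofLp = 0 := congrArg WithLp.ofLp h
    have hli : LinearIndependent ℝ ![(d 0 z).ofLp, (d 1 z).ofLp] := by
      rw [LinearIndependent.pair_iff]
      intro s t hst
      have : fderiv ℝ f z (s • e 0 + t • e 1) = 0 := by
        rw [map_add, map_smul, map_smul]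
        exact (WithLp.ofLp_injective 2) hst
      have h1 := hinj z hz (this.trans (map_zero _).symm)
      exact ⟨by simpa [he] using congrArg (fun w : E2 => w 0) h1,
        by simpa [he] using congrArg (fun w : E2 => w 1) h1⟩
    exact crossProduct_ne_zero_iff_linearIndependent.mpr hli h0
  have hperp (z : E2) (i : Fin 2) : inner ℝ (d i z) (m z) = (0 : ℝ) := by
    rw [real_inner_comm, EuclideanSpace.inner_eq_star_dotProduct]
    fin_cases i
    · simp [hm]
    · simp [hm]
  refine ⟨fun z => ‖m z‖⁻¹ • m z, ?_, fun z hz => ⟨?_, fun v => ?_⟩⟩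
  · exact ContDiffOn.smul ((hsm.norm ℝ hm0).inv fun z hz => norm_ne_zero_iff.mpr (hm0 z hz)) hsm
  · rw [norm_smul, norm_inv, norm_norm, inv_mul_cancel₀ (norm_ne_zero_iff.mpr (hm0 z hz))]
  · rw [hexp v, map_add, map_smul, map_smul, inner_add_left, real_inner_smul_left,
      real_inner_smul_left, real_inner_smul_right, real_inner_smul_right]
    change v 0 * (_ * inner ℝ (d 0 z) (m z)) + v 1 * (_ * inner ℝ (d 1 z) (m z)) = (0 : ℝ)
    rw [hperp, hperp]
    ring

/-! ### Passage between the surface and its charts. -/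

section

variable {M : Type*} [TopologicalSpace M] [ChartedSpace E2 M]

/-- At the base point of the chart the tangent space is identified with `E2` through this very
chart, so no transition factor appears. -/
lemma surfaceDiff_eq_fderiv {F : M → E3} {p : M} (hF : MDifferentiableAt 𝓘(ℝ, E2) 𝓘(ℝ, E3) F p) :
    surfaceDiff F p =
      fderiv ℝ (F ∘ (extChartAt 𝓘(ℝ, E2) p).symm) (extChartAt 𝓘(ℝ, E2) p p) := by
  have h : HasFDerivWithinAt (F ∘ (extChartAt 𝓘(ℝ, E2) p).symm) (surfaceDiff F p)
    (Set.range 𝓘(ℝ, E2)) (extChartAt 𝓘(ℝ, E2) p p) := hF.hasMFDerivAt.2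
  exact (h.hasFDerivAt (by simp)).fderiv.symm

variable [IsManifold 𝓘(ℝ, E2) ∞ M]

/-- A smooth surface in the chart at a point is a smooth map on an open subset of the plane. -/
lemma ContMDiff.contDiffOn_comp_extChartAt_symm {F : M → E3}
    (hF : ContMDiff 𝓘(ℝ, E2) 𝓘(ℝ, E3) ∞ F) (p : M) :
    ContDiffOn ℝ ∞ (F ∘ (extChartAt 𝓘(ℝ, E2) p).symm) (extChartAt 𝓘(ℝ, E2) p).target := by
  rw [← contMDiffOn_iff_contDiffOn]
  exact hF.comp_contMDiffOn (contMDiffOn_extChartAt_symm p)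

/-- Away from the base point the chain rule brings in the differential `A` of the inverse chart. Its
injectivity carries the immersion property into the chart. -/
lemma exists_fderiv_comp_extChartAt_symm {F : M → E3} {p : M} {y : E2}
    (hy : y ∈ (extChartAt 𝓘(ℝ, E2) p).target)
    (hF : MDifferentiableAt 𝓘(ℝ, E2) 𝓘(ℝ, E3) F ((extChartAt 𝓘(ℝ, E2) p).symm y)) :
    ∃ A : E2 → E2, Function.Injective A ∧
      ∀ v, fderiv ℝ (F ∘ (extChartAt 𝓘(ℝ, E2) p).symm) y v =
        surfaceDiff F ((extChartAt 𝓘(ℝ, E2) p).symm y) (A v) := by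
  have hφ : MDifferentiableAt 𝓘(ℝ, E2) 𝓘(ℝ, E2) (extChartAt 𝓘(ℝ, E2) p).symm y :=
    ((contMDiffOn_extChartAt_symm (n := ∞) p).contMDiffAt
      ((isOpen_extChartAt_target p).mem_nhds hy)).mdifferentiableAt (by simp)
  have h := mfderiv_comp y hF hφ
  rw [mfderiv_eq_fderiv] at h
  have hinj := (isInvertible_mfderivWithin_extChartAt_symm (I := 𝓘(ℝ, E2)) hy).injective
  rw [modelWithCornersSelf_coe, Set.range_id, mfderivWithin_univ] at hinj
  exact ⟨mfderiv 𝓘(ℝ, E2) 𝓘(ℝ, E2) (extChartAt 𝓘(ℝ, E2) p).symm y, hinj,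
    fun v => congrArg (fun T : E2 →L[ℝ] E3 => T v) h⟩

/-- The converse passage: a field normal in the chart is normal to every tangent vector of the
surface. -/
lemma exists_surfaceDiff_eq_fderiv {F : M → E3} {p q : M}
    (hq : q ∈ (extChartAt 𝓘(ℝ, E2) p).source)
    (hF : DifferentiableAt ℝ (F ∘ (extChartAt 𝓘(ℝ, E2) p).symm) (extChartAt 𝓘(ℝ, E2) p q)) :
    ∃ A : E2 → E2, ∀ v, surfaceDiff F q v =
      fderiv ℝ (F ∘ (extChartAt 𝓘(ℝ, E2) p).symm) (extChartAt 𝓘(ℝ, E2) p q) (A v) := by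
  have hφ : MDifferentiableAt 𝓘(ℝ, E2) 𝓘(ℝ, E2) (extChartAt 𝓘(ℝ, E2) p) q :=
    (contMDiffAt_extChartAt' (n := ∞) (by simpa using hq)).mdifferentiableAt (by simp)
  have h := mfderiv_comp q hF.mdifferentiableAt hφ
  rw [mfderiv_eq_fderiv] at h
  have hloc : F =ᶠ[𝓝 q] (F ∘ (extChartAt 𝓘(ℝ, E2) p).symm) ∘ extChartAt 𝓘(ℝ, E2) p := by
    filter_upwards [(isOpen_extChartAt_source (I := 𝓘(ℝ, E2)) p).mem_nhds hq] with z hz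
    simp only [Function.comp_apply, (extChartAt 𝓘(ℝ, E2) p).left_inv hz]
  have h' : surfaceDiff F q =
      mfderiv 𝓘(ℝ, E2) 𝓘(ℝ, E3) ((F ∘ (extChartAt 𝓘(ℝ, E2) p).symm) ∘ extChartAt 𝓘(ℝ, E2) p) q :=
    hloc.mfderiv_eq
  exact ⟨mfderiv 𝓘(ℝ, E2) 𝓘(ℝ, E2) (extChartAt 𝓘(ℝ, E2) p) q,
    fun v => congrArg (fun T : E2 →L[ℝ] E3 => T v) (h'.trans h)⟩

/-- Near each of its points an immersed surface has a unit normal field. -/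
lemma exists_isUnitNormalNear {F : M → E3} (hF : ContMDiff 𝓘(ℝ, E2) 𝓘(ℝ, E3) ∞ F)
    (hinj : ∀ p, Function.Injective (surfaceDiff F p)) (p : M) :
    ∃ N, IsUnitNormalNear F N p := by
  set φ := extChartAt 𝓘(ℝ, E2) p with hφ
  have hf := hF.contDiffOn_comp_extChartAt_symm p
  have hfi : ∀ y ∈ φ.target, Function.Injective (fderiv ℝ (F ∘ φ.symm) y) := by
    intro y hy
    obtain ⟨A, hA, hFA⟩ := exists_fderiv_comp_extChartAt_symm hy (hF.mdifferentiableAt (by simp))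
    intro v w hvw
    rw [hFA, hFA] at hvw
    exact hA (hinj _ hvw)
  obtain ⟨n, hn, hn1⟩ := exists_contDiffOn_unitNormal (isOpen_extChartAt_target p) hf hfi
  refine ⟨n ∘ φ, ?_, ?_⟩
  · exact (hn.contDiffAt ((isOpen_extChartAt_target p).mem_nhds
      (mem_extChartAt_target p))).contMDiffAt.comp p contMDiffAt_extChartAt
  · filter_upwards [(isOpen_extChartAt_source (I := 𝓘(ℝ, E2)) p).mem_nhds
      (mem_extChartAt_source p)] with q hq
    refine ⟨(hn1 _ (φ.map_source hq)).1, fun v => ?_⟩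
    obtain ⟨A, hA⟩ := exists_surfaceDiff_eq_fderiv hq ((hf.contDiffAt
      ((isOpen_extChartAt_target p).mem_nhds (φ.map_source hq))).differentiableAt (by simp))
    rw [hA]
    exact (hn1 _ (φ.map_source hq)).2 _

end

/-! ### Outward growth where the mean curvature is large. -/

lemma HasDerivAt.eventually_lt_of_pos {g : ℝ → ℝ} {g' t : ℝ} (h : HasDerivAt g g' t)
    (hg' : 0 < g') : ∀ᶠ s in 𝓝[>] (0 : ℝ), g t < g (t + s) := by
  filter_upwards [h.tendsto_slope_zero_right.eventually (lt_mem_nhds hg'), self_mem_nhdsWithin]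
    with s hs hs0
  have hs1 : (0 : ℝ) < s := hs0
  have := (mul_pos_iff_of_pos_left (inv_pos.mpr hs1)).mp hs
  linarith

section

variable {M : Type*} [TopologicalSpace M] [ChartedSpace E2 M] [IsManifold 𝓘(ℝ, E2) ∞ M]

/-- The curvature bound for the spherical sections of a surface bounds its second fundamental form
in the direction of these sections. -/
lemma exists_tangent_levelCurve_curvature_le {F N : M → E3} {S : Set M} {q : M} {κ : ℝ}
    (hF : ContMDiff 𝓘(ℝ, E2) 𝓘(ℝ, E3) ∞ F) (hinj : Function.Injective (surfaceDiff F q))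
    (hN : IsUnitNormalNear F N q) (hS : IsOpen S) (hq : q ∈ S)
    (hreg : ∃ v, inner ℝ (surfaceDiff F q v) (F q) ≠ (0 : ℝ))
    (hκ : SphereTraceCurvatureLE F S ‖F q‖ κ) :
    ∃ u, ‖surfaceDiff F q u‖ = 1 ∧ inner ℝ (surfaceDiff F q u) (F q) = (0 : ℝ) ∧
      |inner ℝ (surfaceDiff N q u) (surfaceDiff F q u)| ≤
        κ + |inner ℝ (F q) (N q)| / ‖F q‖ ^ 2 := by
  set φ := extChartAt 𝓘(ℝ, E2) q with hφ
  set f := F ∘ φ.symm with hfdef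
  have hφq : φ.symm (φ q) = q := extChartAt_to_inv q
  have hfq : f (φ q) = F q := congrArg F hφq
  have hf : ContDiffOn ℝ ∞ f φ.target := hF.contDiffOn_comp_extChartAt_symm q
  have hLf : surfaceDiff F q = fderiv ℝ f (φ q) :=
    surfaceDiff_eq_fderiv (hF.mdifferentiableAt (by simp))
  have hNd : MDifferentiableAt 𝓘(ℝ, E2) 𝓘(ℝ, E3) N q := hN.1.mdifferentiableAt (by simp)
  have hKn : surfaceDiff N q = fderiv ℝ (N ∘ φ.symm) (φ q) := surfaceDiff_eq_fderiv hNd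
  have hsymm : ContMDiffOn 𝓘(ℝ, E2) 𝓘(ℝ, E2) ∞ φ.symm φ.target := contMDiffOn_extChartAt_symm q
  have hnd : DifferentiableAt ℝ (N ∘ φ.symm) (φ q) := by
    rw [← mdifferentiableAt_iff_differentiableAt]
    refine MDifferentiableAt.comp _ (by rwa [hφq]) ?_
    exact (hsymm.contMDiffAt (extChartAt_target_mem_nhds q)).mdifferentiableAt (by simp)
  set U := φ.target ∩ φ.symm ⁻¹' S with hU
  have hUo : IsOpen U := (continuousOn_extChartAt_symm q).isOpen_inter_preimage
    (isOpen_extChartAt_target q) hS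
  have hqU : φ q ∈ U := ⟨mem_extChartAt_target q, by rw [Set.mem_preimage, hφq]; exact hq⟩
  have hF0 : F q ≠ 0 := by
    rintro h
    obtain ⟨v, hv⟩ := hreg
    exact hv (by rw [h, inner_zero_right])
  obtain ⟨δ, hδ, c, hc0, hcs, hc⟩ := exists_unitSpeed_levelCurve hUo
    (hf.mono Set.inter_subset_left) hqU (by rwa [← hLf]) (by rwa [← hLf, hfq])
  have h0 : (0 : ℝ) ∈ Set.Ioo (-δ) δ := ⟨by linarith, hδ⟩
  have hI : ∀ᶠ t in 𝓝 (0 : ℝ), t ∈ Set.Ioo (-δ) δ := isOpen_Ioo.mem_nhds h0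
  have hcd : ∀ t ∈ Set.Ioo (-δ) δ, HasDerivAt c (deriv c t) t := fun t ht =>
    ((hcs.contDiffAt (isOpen_Ioo.mem_nhds ht)).differentiableAt (by simp)).hasDerivAt
  have hγd : ∀ t ∈ Set.Ioo (-δ) δ, deriv (f ∘ c) t = fderiv ℝ f (c t) (deriv c t) := by
    intro t ht
    have hfd : DifferentiableAt ℝ f (c t) := (hf.contDiffAt ((isOpen_extChartAt_target q).mem_nhds
      (hc t ht).1.1)).differentiableAt (by simp)
    exact (hfd.hasFDerivAt.comp_hasDerivAt t (hcd t ht)).deriv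
  have hγ : ContDiffAt ℝ 2 (f ∘ c) 0 := by
    have h := (hf.comp hcs fun t ht => (hc t ht).1.1).contDiffAt (isOpen_Ioo.mem_nhds h0)
    exact h.of_le (WithTop.coe_le_coe.mpr le_top)
  have hcurv : sphereGeodesicCurvature (f ∘ c) 0 ≤ κ := by
    refine hκ (-δ) δ (φ.symm ∘ c) ?_ ?_ 0 h0
    · exact hsymm.comp hcs.contMDiffOn fun t ht => (hc t ht).1.1
    · intro t ht
      obtain ⟨h1, h2, h3⟩ := hc t ht
      exact ⟨h1.2, by rw [← hfq, ← h2]; rfl, h3⟩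
  have hdn : HasDerivAt (N ∘ φ.symm ∘ c) (surfaceDiff N q (deriv c 0)) 0 := by
    rw [hKn]
    have h := hnd.hasFDerivAt
    rw [← hc0] at h ⊢
    exact h.comp_hasDerivAt 0 (hcd 0 h0)
  have hψ : ContinuousAt (φ.symm ∘ c) 0 := by
    refine ContinuousAt.comp ?_ (hcd 0 h0).continuousAt
    rw [hc0]
    exact continuousAt_extChartAt_symm q
  have hψ0 : (φ.symm ∘ c) 0 = q := by rw [Function.comp_apply, hc0, hφq]
  have hperp : ∀ᶠ t in 𝓝 0, inner ℝ (deriv (f ∘ c) t) ((N ∘ φ.symm ∘ c) t) = (0 : ℝ) := by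
    have hev := hN.2
    rw [← hψ0] at hev
    filter_upwards [hψ.eventually hev, hI] with t ht htI
    obtain ⟨A, -, hA⟩ := exists_fderiv_comp_extChartAt_symm (F := F) (hc t htI).1.1
      (hF.mdifferentiableAt (by simp))
    rw [hγd t htI, hfdef, hA]
    exact ht.2 _
  have hd0 : deriv (f ∘ c) 0 = surfaceDiff F q (deriv c 0) := by
    rw [hγd 0 h0, hc0, hLf]
  have hN0 : (N ∘ φ.symm ∘ c) 0 = N q := congrArg N hψ0
  have hf0 : (f ∘ c) 0 = F q := by rw [Function.comp_apply, hc0, hfq]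
  have hmain := abs_inner_deriv_normal_le (norm_pos_iff.mpr hF0) hγ hdn
    (by rw [hN0]; exact hN.2.self_of_nhds.1)
    (by filter_upwards [hI] with t ht; rw [Function.comp_apply, (hc t ht).2.1, hfq])
    (by filter_upwards [hI] with t ht using (hc t ht).2.2) hperp
  rw [hN0, hf0, hd0] at hmain
  refine ⟨deriv c 0, ?_, ?_, hmain.trans (by linarith)⟩
  · rw [← hd0]
    exact (hc 0 h0).2.2
  · have hdiff : HasDerivAt (f ∘ c) (surfaceDiff F q (deriv c 0)) 0 := by
      rw [← hd0]
      exact (hγ.differentiableAt (by simp)).hasDerivAt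
    have h1 := hdiff.norm_sq
    have h2 : HasDerivAt (fun t => ‖(f ∘ c) t‖ ^ 2) 0 0 := by
      refine (hasDerivAt_const (0 : ℝ) (‖F q‖ ^ 2)).congr_of_eventuallyEq ?_
      filter_upwards [hI] with t ht
      rw [Function.comp_apply, (hc t ht).2.1, hfq]
    have h3 := h1.unique h2
    rw [hf0] at h3
    rw [real_inner_comm]
    linarith

/-- Where the mean curvature of a self-shrinker is larger than `2`, moving outwards in the surface
makes `4 * H ^ 2 - 2 * |x| ^ 2` grow. -/
lemma exists_path_normal_growth {F N : M → E3} {S : Set M} {q : M} {κ : ℝ}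
    (hF : ContMDiff 𝓘(ℝ, E2) 𝓘(ℝ, E3) ∞ F) (hinj : Function.Injective (surfaceDiff F q))
    (hN : IsUnitNormalNear F N q) (hS : IsOpen S) (hq : q ∈ S)
    (hreg : ∃ v, inner ℝ (surfaceDiff F q v) (F q) ≠ (0 : ℝ))
    (hκ : SphereTraceCurvatureLE F S ‖F q‖ κ) (hκ' : κ ≤ 1 / 2) (hr : 4 ≤ ‖F q‖)
    (hH : surfaceDiv F N q = inner ℝ (F q) (N q) / 2)
    (hs : 16 < (inner ℝ (F q) (N q) : ℝ) ^ 2) :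
    ∃ c : ℝ → M, Filter.Tendsto c (𝓝[>] 0) (𝓝 q) ∧ ∀ᶠ t in 𝓝[>] 0,
      ‖F q‖ ^ 2 < ‖F (c t)‖ ^ 2 ∧ (inner ℝ (F q) (N q) : ℝ) ^ 2 - 2 * ‖F q‖ ^ 2 <
        (inner ℝ (F (c t)) (N (c t)) : ℝ) ^ 2 - 2 * ‖F (c t)‖ ^ 2 := by
  obtain ⟨u, hu1, hu0, hu⟩ := exists_tangent_levelCurve_curvature_le hF hinj hN hS hq hreg hκ
  have hN1 : ‖N q‖ = 1 := hN.2.self_of_nhds.1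
  have hNL : ∀ v, inner ℝ (surfaceDiff F q v) (N q) = (0 : ℝ) := hN.2.self_of_nhds.2
  -- The image of `w` is the tangential part of `x`, the outward direction in the surface.
  obtain ⟨w, hw⟩ := exists_eq_add_smul_normal _ hinj _ hN1 hNL (F q)
  set s : ℝ := inner ℝ (F q) (N q) with hsdef
  set φ := extChartAt 𝓘(ℝ, E2) q with hφ
  have hφq : φ.symm (φ q) = q := extChartAt_to_inv q
  have hsymm : MDifferentiableAt 𝓘(ℝ, E2) 𝓘(ℝ, E2) φ.symm (φ q) :=
    ((contMDiffOn_extChartAt_symm (n := ∞) q).contMDiffAt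
      (extChartAt_target_mem_nhds q)).mdifferentiableAt (by simp)
  have key (P : M → E3) (hP : MDifferentiableAt 𝓘(ℝ, E2) 𝓘(ℝ, E3) P q) (v : E2) :
      HasDerivAt (fun t : ℝ => P (φ.symm (φ q + t • v))) (surfaceDiff P q v) 0 := by
    have hd : DifferentiableAt ℝ (P ∘ φ.symm) (φ q) := by
      rw [← mdifferentiableAt_iff_differentiableAt]
      exact MDifferentiableAt.comp _ (by rwa [hφq]) hsymm
    rw [surfaceDiff_eq_fderiv hP]
    have hline : HasDerivAt (fun t : ℝ => φ q + t • v) v 0 := by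
      simpa using ((hasDerivAt_id (0 : ℝ)).smul_const v).const_add (φ q)
    refine HasFDerivAt.comp_hasDerivAt (l := P ∘ φ.symm) 0 ?_ hline
    rw [zero_smul, add_zero]
    exact hd.hasFDerivAt
  have hFd : MDifferentiableAt 𝓘(ℝ, E2) 𝓘(ℝ, E3) F q := hF.mdifferentiableAt (by simp)
  have hNd : MDifferentiableAt 𝓘(ℝ, E2) 𝓘(ℝ, E3) N q := hN.1.mdifferentiableAt (by simp)
  set c : ℝ → M := fun t => φ.symm (φ q + t • w) with hc
  have hc0 : c 0 = q := by simp [hc, hφq]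
  have hcc : ContinuousAt c 0 := by
    refine ContinuousAt.comp (g := φ.symm) (f := fun t : ℝ => φ q + t • w) ?_ (by fun_prop)
    rw [zero_smul, add_zero]
    exact continuousAt_extChartAt_symm q
  have hdF : HasDerivAt (fun t => F (c t)) (surfaceDiff F q w) 0 := key F hFd w
  have hdN : HasDerivAt (fun t => N (c t)) (surfaceDiff N q w) 0 := key N hNd w
  have hNN : inner ℝ (N q) (surfaceDiff N q w) = (0 : ℝ) := by
    have h1 := hdN.norm_sq
    have h2 : HasDerivAt (fun t => ‖N (c t)‖ ^ 2) 0 0 := by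
      refine (hasDerivAt_const (0 : ℝ) (1 : ℝ)).congr_of_eventuallyEq ?_
      have hev := hN.2
      rw [← hc0] at hev
      filter_upwards [hcc.eventually hev] with t ht
      rw [ht.1, one_pow]
    have h3 := h1.unique h2
    rw [hc0] at h3
    linarith
  set L := surfaceDiff F q with hL
  set K := surfaceDiff N q with hK
  have hLw : inner ℝ (F q) (L w) = ‖L w‖ ^ 2 := by
    conv_lhs => rw [hw]
    rw [inner_add_left, real_inner_smul_left, real_inner_comm (L w) (N q), hNL,
      real_inner_self_eq_norm_sq]
    ring
  -- As `dN w ⟂ N`, only the tangential part of `x` contributes to the derivative of `⟨x, N⟩`.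
  have hKw : inner ℝ (F q) (K w) = (inner ℝ (K w) (L w) : ℝ) := by
    conv_lhs => rw [hw]
    rw [inner_add_left, real_inner_smul_left, hNN, real_inner_comm]
    ring
  have hw0 : L w ≠ 0 := by
    intro h
    obtain ⟨v, hv⟩ := hreg
    apply hv
    rw [hw, h, zero_add, real_inner_smul_right, hNL, mul_zero]
  set l := ‖L w‖ with hl
  have hl0 : 0 < l := norm_pos_iff.mpr hw0
  have huw : inner ℝ (L u) (L w) = (0 : ℝ) := by
    have : L w = F q - s • N q := by
      rw [eq_sub_iff_add_eq]
      exact hw.symm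
    rw [this, inner_sub_right, hu0, real_inner_smul_right, hNL]
    ring
  -- The trace is taken in the basis `u, w / l`, which `L` maps to an orthonormal pair.
  have htr : s / 2 = inner ℝ (K u) (L u) + (inner ℝ (K w) (L w) : ℝ) / l ^ 2 := by
    have hww : inner ℝ (L (l⁻¹ • w)) (L (l⁻¹ • w)) = (1 : ℝ) := by
      rw [map_smul, real_inner_smul_left, real_inner_smul_right, real_inner_self_eq_norm_sq, ← hl]
      field_simp
    have huw' : inner ℝ (L u) (L (l⁻¹ • w)) = (0 : ℝ) := by
      rw [map_smul, real_inner_smul_right, huw, mul_zero]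
    have hwu' : inner ℝ (L (l⁻¹ • w)) (L u) = (0 : ℝ) := by rw [real_inner_comm, huw']
    have huu : inner ℝ (L u) (L u) = (1 : ℝ) := by
      rw [real_inner_self_eq_norm_sq, hu1, one_pow]
    have h := trace_gram_inv_mul_eq_sum L K ![u, l⁻¹ • w] (by
      intro i j
      fin_cases i <;> fin_cases j
      exacts [huu, huw', hwu', hww])
    rw [← hH, surfaceDiv, firstFundamentalForm]
    refine h.trans ?_
    simp only [Fin.sum_univ_two, Matrix.cons_val_zero, Matrix.cons_val_one, map_smul,
      real_inner_smul_left, real_inner_smul_right]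
    field_simp
  have ha : |inner ℝ (K u) (L u)| ≤ 1 / 2 + |s| / 16 := by
    refine hu.trans (add_le_add hκ' ?_)
    exact div_le_div_of_nonneg_left (abs_nonneg _) (by norm_num) (by nlinarith)
  -- The left factor's size suffices: `s²/2 - |s|(1/2 + |s|/16) = 7s²/16 - |s|/2 > 5` once `|s| >
  -- 4`.
  have hgrow : 2 < s * (s / 2 - inner ℝ (K u) (L u)) := by
    have h4 : 4 < |s| := by
      rw [← sq_abs] at hs
      nlinarith [abs_nonneg s]
    have h5 : s * inner ℝ (K u) (L u) ≤ |s| * (1 / 2 + |s| / 16) :=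
      (le_abs_self _).trans (by rw [abs_mul]; gcongr)
    nlinarith [sq_abs s]
  have hd1 := hdF.norm_sq
  -- This derivative equals `2l² (s (s/2 - k) - 2)`, where `k = ⟨K u, L u⟩`.
  have hd2 := ((hdF.inner ℝ hdN).pow 2).sub (hd1.const_mul 2)
  have hpos1 := hd1.eventually_lt_of_pos (by
    rw [hc0, hLw]
    positivity)
  have hpos2 := hd2.eventually_lt_of_pos (by
    rw [hc0, hLw, hKw, hNL]
    have hB : (inner ℝ (K w) (L w) : ℝ) = l ^ 2 * (s / 2 - inner ℝ (K u) (L u)) := by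
      rw [htr]
      field_simp
      ring
    rw [hB]
    have : 0 < l ^ 2 * (s * (s / 2 - inner ℝ (K u) (L u)) - 2) :=
      mul_pos (pow_pos hl0 2) (by linarith)
    push_cast
    ring_nf at this ⊢
    linarith)
  refine ⟨c, ?_, ?_⟩
  · have h := hcc.tendsto
    rw [hc0] at h
    exact h.mono_left nhdsWithin_le_nhds
  · filter_upwards [hpos1, hpos2] with t h1 h2
    simp only [zero_add, hc0, Pi.sub_apply, Pi.pow_apply] at h1 h2
    exact ⟨h1, h2⟩

end

/-! ### Independence of the normal, transversality and topology of ends. -/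

section

variable {M : Type*} [TopologicalSpace M] [ChartedSpace E2 M]

lemma sq_inner_eq_of_unit_normals {F : M → E3} {p : M} (hinj : Function.Injective (surfaceDiff F p))
    {n m : E3} (hn : ‖n‖ = 1) (hm : ‖m‖ = 1) (hFn : ∀ v, inner ℝ (surfaceDiff F p v) n = (0 : ℝ))
    (hFm : ∀ v, inner ℝ (surfaceDiff F p v) m = (0 : ℝ)) (x : E3) :
    (inner ℝ x n : ℝ) ^ 2 = (inner ℝ x m : ℝ) ^ 2 := by
  have h (y : E3) : inner ℝ y m = (inner ℝ y n : ℝ) * inner ℝ n m := by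
    obtain ⟨w, hw⟩ := exists_eq_add_smul_normal _ hinj n hn hFn y
    conv_lhs => rw [hw]
    rw [inner_add_left, hFm, real_inner_smul_left, zero_add]
  have h1 := h m
  rw [real_inner_self_eq_norm_sq, hm, real_inner_comm] at h1
  rw [h x, mul_pow, sq (inner ℝ n m : ℝ), ← h1]
  ring

/-- Otherwise the tangent plane lies in `x^⊥`, and the two together miss `x ≠ 0`. -/
lemma exists_inner_ne_zero_of_meetsSphereTransversally {F : M → E3} {S : Set M} {q : M}
    (hq : q ∈ S) (hq0 : F q ≠ 0) (h : MeetsSphereTransversally F S ‖F q‖) :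
    ∃ v, inner ℝ (surfaceDiff F q v) (F q) ≠ (0 : ℝ) := by
  by_contra! hc
  have hle : LinearMap.range (surfaceDiff F q : E2 →ₗ[ℝ] E3) ≤ (Submodule.span ℝ {F q})ᗮ := by
    rintro _ ⟨v, rfl⟩
    rw [Submodule.mem_orthogonal_singleton_iff_inner_left]
    exact hc v
  have ht := h q hq rfl
  rw [sup_eq_right.mpr hle] at ht
  have hm : F q ∈ (Submodule.span ℝ {F q})ᗮ := ht ▸ Submodule.mem_top
  rw [Submodule.mem_orthogonal_singleton_iff_inner_left, inner_self_eq_zero] at hm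
  exact hq0 hm

lemma IsEnd.isOpen {F : M → E3} (hF : Continuous F) {r₀ : ℝ} {S : Set M} (hS : IsEnd F r₀ S) :
    IsOpen S := by
  obtain ⟨p, -, rfl⟩ := hS
  have : LocallyConnectedSpace M := ChartedSpace.locallyConnectedSpace E2 M
  exact (isOpen_lt continuous_const hF.norm).connectedComponentIn

/-- A component is relatively closed in `{r₀ < ‖F‖}`; cutting at `r > r₀` discards any further limit
points. -/
lemma IsEnd.isClosed_inter {F : M → E3} (hF : Continuous F) {r₀ : ℝ} {S : Set M}
    (hS : IsEnd F r₀ S) {r : ℝ} (hr : r₀ < r) : IsClosed (S ∩ {q | r ≤ ‖F q‖}) := by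
  obtain ⟨p, -, rfl⟩ := hS
  have : LocallyConnectedSpace M := ChartedSpace.locallyConnectedSpace E2 M
  set U := {q | r₀ < ‖F q‖} with hU
  have hUo : IsOpen U := isOpen_lt continuous_const hF.norm
  have heq : connectedComponentIn U p ∩ {q | r ≤ ‖F q‖} =
      closure (connectedComponentIn U p) ∩ {q | r ≤ ‖F q‖} := by
    refine Set.Subset.antisymm (Set.inter_subset_inter_left _ subset_closure) ?_
    rintro y ⟨hy, hyr⟩
    refine ⟨?_, hyr⟩
    have hyU : y ∈ U := hr.trans_le hyr
    obtain ⟨z, hzy, hzp⟩ := mem_closure_iff.mp hy _ hUo.connectedComponentIn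
      (mem_connectedComponentIn hyU)
    rw [connectedComponentIn_eq hzp, ← connectedComponentIn_eq hzy]
    exact mem_connectedComponentIn hyU
  rw [heq]
  exact isClosed_closure.inter (isClosed_le continuous_const hF.norm)

end

/-! ### The maximum argument in a spherical shell. -/

theorem mainTheorem9 (ε : ℝ) (hε : 0 < ε) :
    ∃ R : ℝ, 0 < R ∧
      ∀ (M : Type*) [TopologicalSpace M] [T2Space M] [ChartedSpace E2 M]
        [IsManifold 𝓘(ℝ, E2) ∞ M] (F : M → E3) (r₀ : ℝ) (S : Set M),
        IsProperSelfShrinker F → R ≤ r₀ → IsEnd F r₀ S →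
        (∀ r, r₀ < r → MeetsSphereTransversally F S r) →
        (∀ r, r₀ < r → SphereTraceCurvatureLE F S r (1 / 2 - ε)) →
        MeanCurvatureBoundedBy F S 2 := by
  refine ⟨4, by norm_num, ?_⟩
  intro M _ _ _ _ F r₀ S hF hR hS htrans hcurv p hp N hN
  by_contra! hlt
  have hFc : Continuous F := hF.smooth.continuous
  have hSo : IsOpen S := hS.isOpen hFc
  have hSr : ∀ q ∈ S, r₀ < ‖F q‖ := by
    obtain ⟨p', -, rfl⟩ := hS
    exact fun q hq => connectedComponentIn_subset {q | r₀ < ‖F q‖} p' hq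
  choose ν hν using exists_isUnitNormalNear hF.smooth hF.immersion
  -- The germs `ν z` are chosen independently, so `z ↦ ν z z` may jump in sign; the square does not
  -- see this and is continuous.
  set Q : M → ℝ := fun z => (inner ℝ (F z) (ν z z) : ℝ) ^ 2 with hQ
  have hQN (z : M) (m : M → E3) (hm : IsUnitNormalNear F m z) :
      Q =ᶠ[𝓝 z] fun y => (inner ℝ (F y) (m y) : ℝ) ^ 2 := by
    filter_upwards [hm.2] with y hy
    have hy' := (hν y).2.self_of_nhds
    exact sq_inner_eq_of_unit_normals (hF.immersion y) hy'.1 hy.1 hy'.2 hy.2 _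
  have hQc : Continuous Q := by
    rw [continuous_iff_continuousAt]
    intro z
    refine ContinuousAt.congr ?_ (hQN z (ν z) (hν z)).symm
    exact (Filter.Tendsto.inner hFc.continuousAt (hν z).1.continuousAt).pow 2
  have hQp : 16 < Q p := by
    rw [(hQN p N hN).self_of_nhds]
    rw [hF.shrinker p N hN, abs_div, abs_of_pos (show (0 : ℝ) < 2 by norm_num)] at hlt
    change 16 < (inner ℝ (F p) (N p) : ℝ) ^ 2
    rw [← sq_abs]
    nlinarith
  set r := ‖F p‖ with hr
  have hr4 : 4 < r := hR.trans_lt (hSr p hp)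
  set C : Set M := S ∩ {q | r ≤ ‖F q‖} ∩ {q | ‖F q‖ ^ 2 ≤ 2 * r ^ 2} with hC
  have hCc : IsCompact C := by
    refine (hF.proper.isCompact_preimage (isCompact_closedBall (0 : E3) (2 * r))).of_isClosed_subset
      ((hS.isClosed_inter hFc (hSr p hp)).inter
        (isClosed_le (hFc.norm.pow 2) continuous_const)) ?_
    rintro q ⟨-, hq⟩
    rw [Set.mem_preimage, mem_closedBall_zero_iff]
    rw [Set.mem_ofPred_eq] at hq
    nlinarith [norm_nonneg (F q)]
  have hpC : p ∈ C := ⟨⟨hp, le_refl r⟩, by rw [Set.mem_ofPred_eq, ← hr]; nlinarith⟩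
  obtain ⟨q, ⟨⟨hqS, hqr⟩, hq2⟩, hmax⟩ := hCc.exists_isMaxOn ⟨p, hpC⟩
    (f := fun z => Q z - 2 * ‖F z‖ ^ 2) (by fun_prop)
  rw [Set.mem_ofPred_eq] at hqr hq2
  have hqp : Q p - 2 * r ^ 2 ≤ Q q - 2 * ‖F q‖ ^ 2 := hmax hpC
  have hsq : r ^ 2 ≤ ‖F q‖ ^ 2 := by nlinarith
  rcases hq2.lt_or_eq with hq2 | hq2
  · obtain ⟨c, hc, hgrow⟩ := exists_path_normal_growth hF.smooth (hF.immersion q) (hν q) hSo hqS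
      (exists_inner_ne_zero_of_meetsSphereTransversally hqS
        (norm_pos_iff.mp (by linarith)) (htrans _ (hSr q hqS)))
      (hcurv _ (hSr q hqS)) (by linarith) (by linarith) (hF.shrinker q _ (hν q))
      (show 16 < Q q by linarith)
    have hnear : ∀ᶠ z in 𝓝 q, ‖F z‖ ^ 2 < 2 * r ^ 2 :=
      (hFc.norm.pow 2).continuousAt.eventually (gt_mem_nhds hq2)
    obtain ⟨t, ⟨h1, h2⟩, h3, h4, h5⟩ := (hgrow.and ((hc.eventually hnear).and
      ((hc.eventually (hSo.mem_nhds hqS)).and (hc.eventually (hQN q _ (hν q)))))).exists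
    -- The path moves outwards, so it cannot leave the shell through its inner boundary, even if `‖F
    -- q‖ = r`.
    have hle : Q (c t) - 2 * ‖F (c t)‖ ^ 2 ≤ Q q - 2 * ‖F q‖ ^ 2 :=
      hmax ⟨⟨h4, by rw [Set.mem_ofPred_eq]; nlinarith [norm_nonneg (F (c t))]⟩, h3.le⟩
    rw [h5] at hle
    exact absurd hle (not_le.mpr h2)
  -- On the outer boundary `hqp` gives `Q q ≥ Q p + 2r² > 2r² = ‖F q‖²`, against Cauchy–Schwarz.
  · have hQle : Q q ≤ ‖F q‖ ^ 2 := by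
      have h := abs_real_inner_le_norm (F q) (ν q q)
      rw [(hν q).2.self_of_nhds.1, mul_one] at h
      change (inner ℝ (F q) (ν q q) : ℝ) ^ 2 ≤ _
      rw [← sq_abs]
      exact pow_le_pow_left₀ (abs_nonneg _) h 2
    linarith
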